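/- Let $F$ be a universally complete Riesz space (that is, $F$ is Dedekind complete and every nonempty set of pairwise disjoint positive elements of $F$ has a supremum) with weak order unit $e$, equipped with an $f$-algebra multiplication whose unit is $e$ (an associative bilinear multiplication such that $xy\ge 0$ whenever $x,y\ge 0$, and $(xz)\wedge y=(zx)\wedge y=0$ whenever $x\wedge y=0$ and $z\ge 0$). For $g\in F$ let $\mathcal B_{|g|}$ be the band generated by $|g|$ and $P_{|g|}$ the band projection onto it. Call $h\in F$ a partial inverse of $g$ if $gh=hg=P_{|g|}e$, and a canonical partial inverse of $g$ if in addition $h\in\mathcal B_{|g|}$. Then: 1. every $g\in F$ has a partial inverse; 2. every $g\in F$ has exactly one canonical partial inverse; 3. if $h$ is the canonical partial inverse of $g$, then $g$ is the canonical partial inverse of $h$; 4. if $g\ge 0$, then the canonical partial inverse of $g$ is also $\ge 0$. -/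

import Mathlib

/-!
Riesz spaces (real vector lattices) are expressed through Mathlib's classes
`[AddCommGroup F] [Lattice F] [IsOrderedAddMonoid F] [Module ℝ F] [PosSMulMono ℝ F]`.
-/

namespace RieszSpace

section Order

/-- Dedekind completeness: every nonempty set that is bounded above has a supremum. -/
def IsDedekindComplete (F : Type*) [Lattice F] : Prop :=
  ∀ S : Set F, S.Nonempty → BddAbove S → ∃ s, IsLUB S s

/-- Universal completeness: Dedekind completeness, and every nonempty set of pairwise disjoint
positive elements (not assumed to be bounded) has a supremum. -/
def IsUniversallyComplete (F : Type*) [AddCommGroup F] [Lattice F] : Prop :=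
  IsDedekindComplete F ∧
    ∀ S : Set F, S.Nonempty → (∀ x ∈ S, 0 ≤ x) → S.Pairwise (fun x y => x ⊓ y = 0) →
      ∃ s, IsLUB S s

/-- Two elements that are disjoint from `c` have a difference that is disjoint from `c`. -/
theorem abs_sub_inf_eq_zero {F : Type*} [AddCommGroup F] [Lattice F] [IsOrderedAddMonoid F]
    {u v c : F} (hu : |u| ⊓ |c| = 0) (hv : |v| ⊓ |c| = 0) :
    |u - v| ⊓ |c| = 0 := by
  refine le_antisymm ?_ (le_inf (abs_nonneg _) (abs_nonneg _))
  set w := |u - v| ⊓ |c| with hw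
  have hwc : w ≤ |c| := inf_le_right
  have h1 : w ≤ |u| + |v| := inf_le_left.trans (by
    have := abs_add_le u (-v)
    rwa [abs_neg, ← sub_eq_add_neg] at this)
  have h2 : w - |v| ≤ |u| ⊓ |c| :=
    le_inf (sub_le_iff_le_add.2 h1) ((sub_le_self _ (abs_nonneg v)).trans hwc)
  rw [hu] at h2
  have h3 : w ≤ |v| ⊓ |c| := le_inf (sub_nonpos.1 h2) hwc
  rwa [hv] at h3

end Order

section Bands

variable {F : Type*} [AddCommGroup F] [Lattice F] [Module ℝ F]

/-- A band: a solid linear subspace (an ideal) that contains the supremum of each of its subsets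
that has a supremum in `F`. -/
def IsBand (B : Submodule ℝ F) : Prop :=
  (∀ x ∈ B, ∀ y : F, |y| ≤ |x| → y ∈ B) ∧
    ∀ S : Set F, S ⊆ (B : Set F) → ∀ s, IsLUB S s → s ∈ B

/-- The band generated by `f`: the intersection of all bands that contain `f`. -/
def bandGen (f : F) : Submodule ℝ F :=
  sInf {B : Submodule ℝ F | IsBand B ∧ f ∈ B}

/-- `p` is the component of `x` in `B` with respect to `F = B ⊕ Bᵈ`, where `Bᵈ` is the disjoint
complement of `B`. -/
def IsComponentIn (B : Submodule ℝ F) (x p : F) : Prop :=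
  p ∈ B ∧ ∀ b ∈ B, |x - p| ⊓ |b| = 0

open Classical in
/-- The band projection onto `B`, applied to `x`. The default value `0` never occurs for a band
in a Dedekind complete space: see `isComponentIn_bandProj`. -/
noncomputable def bandProj (B : Submodule ℝ F) (x : F) : F :=
  if h : ∃ p, IsComponentIn B x p then h.choose else 0

/-- `e` is a weak order unit: a positive element that generates `F` as a band. -/
def IsWeakOrderUnit (e : F) : Prop :=
  0 ≤ e ∧ bandGen e = ⊤

theorem isBand_bandGen (f : F) : IsBand (bandGen f) := by
  constructor
  · intro x hx y hxy
    rw [bandGen, Submodule.mem_sInf] at hx ⊢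
    exact fun B hB => hB.1.1 x (hx B hB) y hxy
  · intro S hS s hs
    rw [bandGen, Submodule.mem_sInf]
    intro B hB
    refine hB.1.2 S (fun x hx => ?_) s hs
    have h := hS hx
    rw [SetLike.mem_coe, bandGen, Submodule.mem_sInf] at h
    exact h B hB

theorem mem_bandGen (f : F) : f ∈ bandGen f := by
  rw [bandGen, Submodule.mem_sInf]
  exact fun B hB => hB.2

variable [IsOrderedAddMonoid F]

theorem exists_isComponentIn_of_nonneg (hF : IsDedekindComplete F) {B : Submodule ℝ F}
    (hB : IsBand B) {x : F} (hx : 0 ≤ x) : ∃ p, IsComponentIn B x p := by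
  obtain ⟨p, hp⟩ := hF {b : F | b ∈ B ∧ b ≤ x} ⟨0, B.zero_mem, hx⟩ ⟨x, fun b hb => hb.2⟩
  have hpB : p ∈ B := hB.2 _ (fun b hb => hb.1) p hp
  have hpx : p ≤ x := hp.2 (fun b hb => hb.2)
  refine ⟨p, hpB, fun b hb => ?_⟩
  rw [abs_of_nonneg (sub_nonneg.2 hpx)]
  have h0 : 0 ≤ (x - p) ⊓ |b| := le_inf (sub_nonneg.2 hpx) (abs_nonneg b)
  have hcB : (x - p) ⊓ |b| ∈ B := hB.1 b hb _ (by rw [abs_of_nonneg h0]; exact inf_le_right)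
  have h1 : p + (x - p) ⊓ |b| ≤ p := by
    refine hp.1 ⟨B.add_mem hpB hcB, ?_⟩
    calc p + (x - p) ⊓ |b| ≤ p + (x - p) := by gcongr; exact inf_le_left
      _ = x := by abel
  exact le_antisymm (by simpa using h1) h0

/-- In a Dedekind complete Riesz space every band is a projection band. -/
theorem isComponentIn_bandProj (hF : IsDedekindComplete F) {B : Submodule ℝ F}
    (hB : IsBand B) (x : F) : IsComponentIn B x (bandProj B x) := by
  have h : ∃ p, IsComponentIn B x p := by
    obtain ⟨p, hp, hp'⟩ := exists_isComponentIn_of_nonneg hF hB (posPart_nonneg x)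
    obtain ⟨q, hq, hq'⟩ := exists_isComponentIn_of_nonneg hF hB (negPart_nonneg x)
    refine ⟨p - q, B.sub_mem hp hq, fun b hb => ?_⟩
    have e : x - (p - q) = (x⁺ - p) - (x⁻ - q) := by
      conv_lhs => rw [← posPart_sub_negPart x]
      abel
    rw [e]
    exact abs_sub_inf_eq_zero (hp' b hb) (hq' b hb)
  rw [bandProj, dif_pos h]
  exact h.choose_spec

theorem IsComponentIn.unique {B : Submodule ℝ F} {x p q : F} (hp : IsComponentIn B x p)
    (hq : IsComponentIn B x q) : p = q := by
  have hm : q - p ∈ B := B.sub_mem hq.1 hp.1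
  have h := abs_sub_inf_eq_zero (hp.2 _ hm) (hq.2 _ hm)
  have e : x - p - (x - q) = q - p := by abel
  rw [e, inf_idem] at h
  have h' : q - p = 0 :=
    le_antisymm (h ▸ le_abs_self (q - p)) (neg_nonpos.1 (h ▸ neg_le_abs (q - p)))
  exact (sub_eq_zero.1 h').symm

end Bands

section FAlgebra

/-- The `f`-algebra axioms, for a Riesz space `F` that is at the same time an associative real
algebra with unit (commutativity is not assumed). -/
class IsFAlgebra (F : Type*) [Ring F] [Lattice F] : Prop where
  mul_nonneg : ∀ x y : F, 0 ≤ x → 0 ≤ y → 0 ≤ x * y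
  mul_inf_eq_zero : ∀ x y z : F, x ⊓ y = 0 → 0 ≤ z → (x * z) ⊓ y = 0
  inf_mul_eq_zero : ∀ x y z : F, x ⊓ y = 0 → 0 ≤ z → (z * x) ⊓ y = 0

variable {F : Type*} [Ring F] [Lattice F] [Algebra ℝ F]

/-- `h` is a partial inverse of `g` (with respect to `e`): `gh = hg = P_{|g|} e`, where `P_{|g|}` is
the band projection onto the band generated by `|g|`. -/
def IsPartialInverse (e g h : F) : Prop :=
  g * h = bandProj (bandGen |g|) e ∧ h * g = bandProj (bandGen |g|) e

/-- `h` is a canonical partial inverse of `g`: a partial inverse of `g` that lies in the band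
generated by `|g|`. -/
def IsCanonicalPartialInverse (e g h : F) : Prop :=
  IsPartialInverse e g h ∧ h ∈ bandGen |g|

end FAlgebra

end RieszSpace

/-! Let `supp g` be the component of 1 in the band of |g|. It is a central idempotent, and by
`mem_bandGen_iff` that band consists of the elements it fixes. Band theory thus becomes ring
algebra, and uniqueness, symmetry and positivity are short computations.

Existence for g ≥ 0 (`exists_inverse_of_nonneg`) is by exhaustion. Zorn gives a maximal disjoint
family of local inverses, and universal completeness gives its supremum s. If g * s missed part of
`supp g`, `exists_component_bounded` would isolate a nonzero component of 1 there on which g is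
bounded and bounded away from 0. Dedekind completeness inverts g on it
(`exists_inverse_of_le_component`), against maximality. A general g reduces to g * g, which is
positive with the same support. -/

namespace RieszSpace

/-! ### Disjointness and multiplication -/

section Disjoint

variable {F : Type*} [Ring F] [Lattice F] [IsFAlgebra F]

/-- Applying the f-algebra axioms once on each side makes a * b disjoint from itself. -/
theorem mul_eq_zero_of_inf_eq_zero {a b : F} (h : a ⊓ b = 0) : a * b = 0 := by
  have ha : 0 ≤ a := h ▸ inf_le_left
  have hb : 0 ≤ b := h ▸ inf_le_right
  have h1 := IsFAlgebra.mul_inf_eq_zero a b b h hb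
  rw [inf_comm] at h1
  simpa using IsFAlgebra.inf_mul_eq_zero b (a * b) a h1 ha

theorem mul_self_of_component {p : F} (hp : p ⊓ (1 - p) = 0) : p * p = p := by
  have h := mul_eq_zero_of_inf_eq_zero hp
  rw [mul_sub, mul_one, sub_eq_zero] at h
  exact h.symm

variable [IsOrderedAddMonoid F]

theorem posPart_mul_negPart_eq_zero (a : F) : a⁺ * a⁻ = 0 :=
  mul_eq_zero_of_inf_eq_zero (posPart_inf_negPart_eq_zero a)

theorem negPart_mul_posPart_eq_zero (a : F) : a⁻ * a⁺ = 0 :=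
  mul_eq_zero_of_inf_eq_zero (by rw [inf_comm, posPart_inf_negPart_eq_zero])

theorem mul_self_eq_posPart_add_negPart (a : F) : a * a = a⁺ * a⁺ + a⁻ * a⁻ := by
  conv_lhs => rw [← posPart_sub_negPart a]
  rw [sub_mul, mul_sub, mul_sub, posPart_mul_negPart_eq_zero, negPart_mul_posPart_eq_zero]
  abel

theorem mul_self_nonneg' (a : F) : 0 ≤ a * a := by
  rw [mul_self_eq_posPart_add_negPart]
  exact add_nonneg (IsFAlgebra.mul_nonneg _ _ (posPart_nonneg a) (posPart_nonneg a))
    (IsFAlgebra.mul_nonneg _ _ (negPart_nonneg a) (negPart_nonneg a))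

instance isOrderedRing : IsOrderedRing F :=
  haveI : ZeroLEOneClass F := ⟨by simpa using mul_self_nonneg' (1 : F)⟩
  .of_mul_nonneg IsFAlgebra.mul_nonneg

/-- If the product of a positive element with `x` vanishes, so does the product with `|x|`. -/
theorem mul_abs_eq_zero {c x : F} (hc : 0 ≤ c) (h : c * x = 0) : c * |x| = 0 := by
  have h1 := IsFAlgebra.inf_mul_eq_zero _ _ c (posPart_inf_negPart_eq_zero x) hc
  rw [inf_comm] at h1
  have h2 := IsFAlgebra.inf_mul_eq_zero _ _ c h1 hc
  have h3 : c * x⁺ = c * x⁻ := by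
    rw [← sub_eq_zero, ← mul_sub, posPart_sub_negPart, h]
  -- The products of c with the two parts of x are disjoint and equal, hence zero.
  rw [h3, inf_idem] at h2
  rw [← posPart_add_negPart, mul_add, h3, h2, add_zero]

theorem mul_eq_zero_of_abs_le {c x y : F} (hc : 0 ≤ c) (h : c * |x| = 0) (hy : |y| ≤ |x|) :
    c * y = 0 := by
  have h1 : c * |y| ≤ 0 := h ▸ mul_le_mul_of_nonneg_left hy hc
  have key : ∀ z : F, 0 ≤ z → z ≤ |y| → c * z = 0 := fun z hz hzy =>
    le_antisymm ((mul_le_mul_of_nonneg_left hzy hc).trans h1) (mul_nonneg hc hz)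
  have hp := key y⁺ (posPart_nonneg y) (by
    rw [← posPart_add_negPart]; exact le_add_of_nonneg_right (negPart_nonneg y))
  have hn := key y⁻ (negPart_nonneg y) (by
    rw [← posPart_add_negPart]; exact le_add_of_nonneg_left (posPart_nonneg y))
  rw [← posPart_sub_negPart y, mul_sub, hp, hn, sub_zero]

theorem mul_eq_zero_of_inf_abs_eq_zero {c x : F} (h : c ⊓ |x| = 0) : c * x = 0 :=
  mul_eq_zero_of_abs_le (h ▸ inf_le_left) (mul_eq_zero_of_inf_eq_zero h) le_rfl

/-- Components of the unit are central. -/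
theorem mul_comm_of_component {p : F} (hp : p ⊓ (1 - p) = 0) (y : F) : p * y = y * p := by
  have key : ∀ z : F, 0 ≤ z → p * z = z * p := by
    intro z hz
    have h1 := mul_eq_zero_of_inf_eq_zero (IsFAlgebra.mul_inf_eq_zero _ _ z hp hz)
    rw [inf_comm] at hp
    have h2 := mul_eq_zero_of_inf_eq_zero (IsFAlgebra.mul_inf_eq_zero _ _ z hp hz)
    rw [mul_sub, mul_one, sub_eq_zero] at h1
    rw [sub_mul, sub_mul, one_mul, sub_eq_zero] at h2
    -- Both products equal p * z * p.
    rw [h1, h2]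
  rw [← posPart_sub_negPart y, mul_sub, sub_mul, key _ (posPart_nonneg y),
    key _ (negPart_nonneg y)]

end Disjoint

/-! ### Archimedean property and absence of nilpotents -/

section Archimedean

variable {F : Type*} [Ring F] [Lattice F] [IsOrderedAddMonoid F]

theorem nonneg_of_add_nonneg_of_disjoint {a b : F} (hab : 0 ≤ a + b) (h : |a| ⊓ |b| = 0) :
    0 ≤ a := by
  have h1 : a⁻ ≤ |b| :=
    sup_le ((neg_le_iff_add_nonneg'.2 hab).trans (le_abs_self b)) (abs_nonneg b)
  have h2 : a⁻ ≤ |a| := by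
    rw [← posPart_add_negPart]; exact le_add_of_nonneg_left (posPart_nonneg a)
  exact negPart_eq_zero.1 (le_antisymm (h ▸ le_inf h2 h1) (negPart_nonneg a))

/-- Adding z maps the set of multiples into itself, so its supremum s satisfies s + z ≤ s. -/
theorem nonpos_of_forall_nsmul_le (hF : IsDedekindComplete F) {z w : F}
    (h : ∀ n : ℕ, n • z ≤ w) : z ≤ 0 := by
  obtain ⟨s, hs⟩ := hF (Set.range fun n : ℕ => n • z) ⟨_, 0, rfl⟩
    ⟨w, by rintro _ ⟨n, rfl⟩; exact h n⟩
  have : s ≤ s - z := hs.2 (by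
    rintro _ ⟨n, rfl⟩
    rw [le_sub_iff_add_le]
    exact hs.1 ⟨n + 1, succ_nsmul z n⟩)
  simpa using this

variable [IsFAlgebra F]

theorem eq_zero_of_mul_self_eq_zero (hF : IsDedekindComplete F) {z : F} (h : z * z = 0) :
    z = 0 := by
  have key : ∀ y : F, 0 ≤ y → y * y = 0 → y = 0 := by
    intro y hy hyy
    refine le_antisymm (nonpos_of_forall_nsmul_le hF (w := 1) fun n => ?_) hy
    -- Since y * y = 0, positivity of this square bounds every multiple of y by 1.
    have h1 := mul_self_nonneg' (n • y - 1)
    have h2 : (n • y - 1) * (n • y - 1) = 1 - (n • y + n • y) := by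
      have h3 : n • y * (n • y) = 0 := by rw [smul_mul_smul_comm, hyy, smul_zero]
      rw [sub_mul, mul_sub, h3, mul_one, one_mul]
      abel
    rw [h2, sub_nonneg] at h1
    exact (le_add_of_nonneg_left (nsmul_nonneg hy n)).trans h1
  have hs := mul_self_eq_posPart_add_negPart z
  rw [h] at hs
  have hp := mul_nonneg (posPart_nonneg z) (posPart_nonneg z)
  have hn := mul_nonneg (negPart_nonneg z) (negPart_nonneg z)
  have h0 := (add_eq_zero_iff_of_nonneg hp hn).1 hs.symm
  rw [← posPart_sub_negPart z, key _ (posPart_nonneg z) h0.1, key _ (negPart_nonneg z) h0.2,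
    sub_zero]

theorem inf_eq_zero_of_mul_eq_zero (hF : IsDedekindComplete F) {a b : F} (ha : 0 ≤ a)
    (hb : 0 ≤ b) (h : a * b = 0) : a ⊓ b = 0 := by
  have h0 : 0 ≤ a ⊓ b := le_inf ha hb
  refine eq_zero_of_mul_self_eq_zero hF (le_antisymm ?_ (mul_nonneg h0 h0))
  exact h ▸ mul_le_mul inf_le_left inf_le_right h0 ha

theorem mul_eq_zero_symm (hF : IsDedekindComplete F) {a b : F} (ha : 0 ≤ a)
    (hb : 0 ≤ b) (h : a * b = 0) : b * a = 0 :=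
  mul_eq_zero_of_inf_eq_zero (by rw [inf_comm, inf_eq_zero_of_mul_eq_zero hF ha hb h])

/-- A right inverse relative to a component of the unit is also a left inverse. -/
theorem left_inverse_of_right_inverse {g h u : F} (hu : u ⊓ (1 - u) = 0)
    (hug : u * g = g) (huh : u * h = h) (hgh : g * h = u)
    (hker : ∀ k : F, 0 ≤ k → g * k = 0 → u * k = 0) : h * g = u := by
  have huu := mul_self_of_component hu
  have hgu : g * u = g := by rw [← mul_comm_of_component hu, hug]
  have hhu : h * u = h := by rw [← mul_comm_of_component hu, huh]
  have hi : h * g * (h * g) = h * g := by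
    rw [mul_assoc, ← mul_assoc g, hgh, ← mul_assoc, hhu]
  have h1 : u * (h * g) = h * g := by rw [← mul_assoc, huh]
  have h2 : h * g * u = h * g := by rw [mul_assoc, hgu]
  -- Being idempotent, the defect is a square and hence positive, so `hker` applies to it.
  have hk : (u - h * g) * (u - h * g) = u - h * g := by
    rw [sub_mul, mul_sub, mul_sub, huu, h1, h2, hi]
    abel
  have h3 := hker (u - h * g) (hk ▸ mul_self_nonneg' _) (by
    rw [mul_sub, ← mul_assoc, hgh, hgu, hug, sub_self])
  rw [mul_sub, huu, h1, sub_eq_zero] at h3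
  exact h3.symm

end Archimedean

/-! ### Supports: bands as idempotents -/

section Support

variable {F : Type*} [Ring F] [Lattice F] [IsOrderedAddMonoid F] [Algebra ℝ F]

/-- The component of the unit in the band generated by `x`. -/
noncomputable def supp (x : F) : F := bandProj (bandGen |x|) 1

theorem isComponentIn_supp (hF : IsDedekindComplete F) (x : F) :
    IsComponentIn (bandGen |x|) 1 (supp x) :=
  isComponentIn_bandProj hF (isBand_bandGen _) 1

theorem self_mem_bandGen_abs (x : F) : x ∈ bandGen |x| :=
  (isBand_bandGen |x|).1 _ (mem_bandGen |x|) x (abs_abs x).ge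

theorem bandGen_abs_le {x y : F} (h : y ∈ bandGen |x|) : bandGen |y| ≤ bandGen |x| :=
  sInf_le ⟨isBand_bandGen |x|, (isBand_bandGen |x|).1 _ h _ (abs_abs y).le⟩

variable [IsFAlgebra F]

theorem supp_nonneg (hF : IsDedekindComplete F) (x : F) : 0 ≤ supp x := by
  have h := isComponentIn_supp hF x
  refine nonneg_of_add_nonneg_of_disjoint (b := 1 - supp x) (by simp) ?_
  rw [inf_comm]
  exact h.2 _ h.1

theorem supp_le_one (hF : IsDedekindComplete F) (x : F) : supp x ≤ 1 := by
  have h := isComponentIn_supp hF x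
  exact sub_nonneg.1 (nonneg_of_add_nonneg_of_disjoint (b := supp x) (by simp) (h.2 _ h.1))

theorem supp_inf_one_sub (hF : IsDedekindComplete F) (x : F) : supp x ⊓ (1 - supp x) = 0 := by
  have h := isComponentIn_supp hF x
  have h1 := h.2 _ h.1
  rwa [abs_of_nonneg (sub_nonneg.2 (supp_le_one hF x)), abs_of_nonneg (supp_nonneg hF x),
    inf_comm] at h1

theorem mem_bandGen_iff (hF : IsDedekindComplete F) {x y : F} :
    y ∈ bandGen |x| ↔ supp x * y = y := by
  have h := isComponentIn_supp hF x
  constructor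
  · intro hy
    have h1 := h.2 y hy
    rw [abs_of_nonneg (sub_nonneg.2 (supp_le_one hF x))] at h1
    have h2 := mul_eq_zero_of_inf_abs_eq_zero h1
    rw [sub_mul, one_mul, sub_eq_zero] at h2
    exact h2.symm
  · intro hy
    -- `supp x` kills y - p and fixes p, so y = p.
    obtain ⟨hp, hp'⟩ := isComponentIn_bandProj hF (isBand_bandGen |x|) y
    set p := bandProj (bandGen |x|) y
    have h1 := hp' _ h.1
    rw [inf_comm, abs_of_nonneg (supp_nonneg hF x)] at h1
    have h2 := mul_eq_zero_of_inf_abs_eq_zero h1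
    have h3 := h.2 p hp
    rw [abs_of_nonneg (sub_nonneg.2 (supp_le_one hF x))] at h3
    have h4 := mul_eq_zero_of_inf_abs_eq_zero h3
    rw [sub_mul, one_mul, sub_eq_zero] at h4
    rw [mul_sub, hy, ← h4, sub_eq_zero] at h2
    rwa [h2]

theorem supp_mul_self (hF : IsDedekindComplete F) (x : F) : supp x * x = x :=
  (mem_bandGen_iff hF).1 (self_mem_bandGen_abs x)

theorem supp_eq_supp (hF : IsDedekindComplete F) {x y : F} (hxy : supp x * y = y)
    (hyx : supp y * x = x) : supp x = supp y := by
  have : bandGen |x| = bandGen |y| :=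
    le_antisymm (bandGen_abs_le ((mem_bandGen_iff hF).2 hyx))
      (bandGen_abs_le ((mem_bandGen_iff hF).2 hxy))
  rw [supp, supp, this]

/-- The annihilator of an element of `[0, 1]` is a band. -/
theorem mul_eq_zero_of_mem_bandGen {c x y : F} (hc : 0 ≤ c) (hc1 : c ≤ 1) (hx : c * x = 0)
    (hy : y ∈ bandGen |x|) : c * y = 0 := by
  let A : Submodule ℝ F :=
    { carrier := {z | c * z = 0}
      add_mem' := fun {a b} ha hb => by
        change c * a = 0 at ha
        change c * b = 0 at hb
        change c * (a + b) = 0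
        rw [mul_add, ha, hb, add_zero]
      zero_mem' := mul_zero c
      smul_mem' := fun t a ha => by
        change c * a = 0 at ha
        change c * (t • a) = 0
        rw [mul_smul_comm, ha, smul_zero] }
  have hA : IsBand A := by
    refine ⟨fun a ha b hb => mul_eq_zero_of_abs_le hc (mul_abs_eq_zero hc ha) hb,
      fun S hS t ht => ?_⟩
    change c * t = 0
    rcases S.eq_empty_or_nonempty with rfl | ⟨s, hs⟩
    · have hbot : ∀ z, t ≤ z := fun z => ht.2 (by simp)
      have : t = 0 := le_antisymm (hbot 0) (by simpa using hbot (t + t))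
      rw [this, mul_zero]
    · apply le_antisymm
      -- Here c ≤ 1 matters: multiplication by 1 - c is monotone and fixes S pointwise.
      · have h1 : t ≤ (1 - c) * t := ht.2 fun z hz => by
          have hz0 : c * z = 0 := hS hz
          have : (1 - c) * z = z := by rw [sub_mul, one_mul, hz0, sub_zero]
          rw [← this]
          exact mul_le_mul_of_nonneg_left (ht.1 hz) (sub_nonneg.2 hc1)
        rw [sub_mul, one_mul] at h1
        simpa using h1
      · have hs0 : c * s = 0 := hS hs
        exact hs0 ▸ mul_le_mul_of_nonneg_left (ht.1 hs) hc
  have h1 : bandGen |x| ≤ A := sInf_le ⟨hA, mul_abs_eq_zero hc hx⟩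
  exact h1 hy

/-- Truncating k at 1 makes its annihilator a band; the truncation is harmless because `supp g` ≤ 1.
-/
theorem mul_supp_eq_zero (hF : IsDedekindComplete F) {k g : F} (hk : 0 ≤ k) (h : k * g = 0) :
    k * supp g = 0 := by
  have hc : 0 ≤ k ⊓ 1 := le_inf hk zero_le_one
  have h1 : (k ⊓ 1) * g = 0 := by
    refine mul_eq_zero_of_abs_le hc (le_antisymm ?_ (mul_nonneg hc (abs_nonneg g))) le_rfl
    exact mul_abs_eq_zero hk h ▸ mul_le_mul_of_nonneg_right inf_le_left (abs_nonneg g)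
  have h2 := inf_eq_zero_of_mul_eq_zero hF hc (supp_nonneg hF g)
    (mul_eq_zero_of_mem_bandGen hc inf_le_right h1 (isComponentIn_supp hF g).1)
  rw [inf_assoc, inf_eq_right.2 (supp_le_one hF g)] at h2
  exact mul_eq_zero_of_inf_eq_zero h2

theorem supp_mul_eq_zero (hF : IsDedekindComplete F) {k g : F} (hk : 0 ≤ k) (h : k * g = 0) :
    supp g * k = 0 :=
  mul_eq_zero_symm hF hk (supp_nonneg hF g) (mul_supp_eq_zero hF hk h)

theorem supp_posPart_mul_nonneg (hF : IsDedekindComplete F) (a : F) : 0 ≤ supp a⁺ * a := by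
  have h := supp_mul_eq_zero hF (negPart_nonneg a) (negPart_mul_posPart_eq_zero a)
  have h1 : supp a⁺ * a = a⁺ := by
    calc supp a⁺ * a = supp a⁺ * (a⁺ - a⁻) := by rw [posPart_sub_negPart]
      _ = a⁺ := by rw [mul_sub, h, sub_zero, supp_mul_self hF]
  exact (posPart_nonneg a).trans_eq h1.symm

theorem supp_posPart_ne_zero (hF : IsDedekindComplete F) {a : F} (ha : ¬ a ≤ 0) :
    supp a⁺ ≠ 0 := by
  intro h
  have h1 := supp_mul_self hF a⁺
  rw [h, zero_mul] at h1
  exact ha (posPart_eq_zero.1 h1.symm)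

/-- Below every nonzero `d` in the band of `g ≥ 0` there is a nonzero component of the unit on which
`g` is bounded and bounded away from `0`. -/
theorem exists_component_bounded (hF : IsDedekindComplete F) {g d : F} (hg : 0 ≤ g) (hd : d ≠ 0)
    (hgd : supp g * d = d) :
    ∃ (r : F) (n m : ℕ), r ≠ 0 ∧ r ⊓ (1 - r) = 0 ∧ r ≤ n * (r * g) ∧ r * g ≤ m * r ∧
      r ≤ n * (r * |d|) := by
  have ha : ¬ |d| ⊓ g ≤ 0 := by
    intro h
    have h1 : |d| ⊓ g = 0 := le_antisymm h (le_inf (abs_nonneg d) hg)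
    have h2 := supp_mul_eq_zero hF (abs_nonneg d) (mul_eq_zero_of_inf_eq_zero h1)
    have h3 := mul_eq_zero_of_abs_le (supp_nonneg hF g) h2 le_rfl
    exact hd (hgd.symm.trans h3)
  obtain ⟨n, hn⟩ : ∃ n : ℕ, ¬ n • (|d| ⊓ g) ≤ 1 := by
    by_contra! h
    exact ha (nonpos_of_forall_nsmul_le hF h)
  set a := n • (|d| ⊓ g) - 1 with ha_def
  set q := supp a⁺
  have hq0 : 0 ≤ q := supp_nonneg hF _
  have hq : q ⊓ (1 - q) = 0 := supp_inf_one_sub hF _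
  have hqa : q ≤ n * (q * (|d| ⊓ g)) := by
    have : 0 ≤ q * a := supp_posPart_mul_nonneg hF a
    rwa [ha_def, mul_sub, mul_one, sub_nonneg, mul_smul_comm, nsmul_eq_mul] at this
  have hqne : q ≠ 0 := supp_posPart_ne_zero hF (by rwa [ha_def, sub_nonpos])
  obtain ⟨m, hm⟩ : ∃ m : ℕ, ¬ m • q ≤ g := by
    by_contra! h
    exact hqne (le_antisymm (nonpos_of_forall_nsmul_le hF h) hq0)
  set b := m • q - g with hb_def
  set r := supp b⁺
  have hr0 : 0 ≤ r := supp_nonneg hF _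
  have hr : r ⊓ (1 - r) = 0 := supp_inf_one_sub hF _
  have hrne : r ≠ 0 := supp_posPart_ne_zero hF (by rwa [hb_def, sub_nonpos])
  have hq1 : 0 ≤ 1 - q := hq ▸ inf_le_right
  -- 1 - q kills the positive part of b, which lies below m • q, and therefore kills its support r.
  have hqr : r * q = r := by
    have h1 : b⁺ ≤ m • q := sup_le (sub_le_self _ hg) (nsmul_nonneg hq0 m)
    have h2 : (1 - q) * b⁺ = 0 := by
      refine le_antisymm ?_ (mul_nonneg hq1 (posPart_nonneg b))
      calc (1 - q) * b⁺ ≤ (1 - q) * (m • q) := mul_le_mul_of_nonneg_left h1 hq1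
        _ = 0 := by rw [mul_smul_comm, sub_mul, one_mul, mul_self_of_component hq, sub_self,
              smul_zero]
    have h3 := supp_mul_eq_zero hF hq1 h2
    rw [mul_sub, mul_one, sub_eq_zero] at h3
    exact h3.symm
  have hra : r ≤ n * (r * (|d| ⊓ g)) := by
    have h1 := mul_le_mul_of_nonneg_left hqa hr0
    rwa [hqr, ← mul_assoc, (Nat.cast_commute n r).eq.symm, mul_assoc, ← mul_assoc r, hqr] at h1
  have hrg : r * g ≤ m * r := by
    have : 0 ≤ r * b := supp_posPart_mul_nonneg hF b
    rwa [hb_def, mul_sub, sub_nonneg, mul_smul_comm, hqr, nsmul_eq_mul] at this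
  refine ⟨r, n, m, hrne, hr, hra.trans ?_, hrg, hra.trans ?_⟩
  · gcongr; exact inf_le_right
  · gcongr; exact inf_le_left

/-- The part of g outside `supp (g * g)` squares to zero. -/
theorem supp_mul_self_eq (hF : IsDedekindComplete F) (g : F) : supp (g * g) = supp g := by
  have hv := supp_inf_one_sub hF (g * g)
  refine supp_eq_supp hF ?_ (by rw [← mul_assoc, supp_mul_self hF])
  have hcomm := mul_comm_of_component hv g
  have h1 : (g - supp (g * g) * g) * (g - supp (g * g) * g) = 0 := by
    have h2 : g * (supp (g * g) * g) = g * g := by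
      rw [← mul_assoc, ← hcomm, mul_assoc, supp_mul_self hF]
    rw [mul_sub, sub_mul, sub_mul, h2, mul_assoc, mul_assoc, h2, supp_mul_self hF, sub_self]
  exact (sub_eq_zero.1 (eq_zero_of_mul_self_eq_zero hF h1)).symm

end Support

/-! ### Construction of inverses -/

section Inverse

variable {F : Type*} [Ring F] [Lattice F] [IsOrderedAddMonoid F] [IsFAlgebra F]

/-- Below a component `r` of the unit on which `g ≤ 1` is bounded away from `0`, the element `g` has
a right inverse. -/
theorem exists_inverse_of_le_component (hF : IsDedekindComplete F) {g r : F} {N : F}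
    (hN : 0 ≤ N) (hr : r ⊓ (1 - r) = 0) (hlow : r ≤ N * (r * g)) (hup : r * g ≤ r) :
    ∃ x, 0 ≤ x ∧ r * x = x ∧ g * x = r := by
  have hr0 : 0 ≤ r := hr ▸ inf_le_left
  have hr1 : 0 ≤ 1 - r := hr ▸ inf_le_right
  have hrr := mul_self_of_component hr
  have hbd : ∀ y : F, 0 ≤ y → r * y = y → g * y ≤ y := by
    intro y hy hry
    have : r * g * y = g * y := by rw [mul_comm_of_component hr, mul_assoc, hry]
    calc g * y = r * g * y := this.symm
      _ ≤ r * y := mul_le_mul_of_nonneg_right hup hy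
      _ = y := hry
  -- The inverse is the largest subsolution; the lower bound on g bounds these by N * r.
  obtain ⟨x, hx⟩ := hF {y | 0 ≤ y ∧ r * y = y ∧ g * y ≤ r}
    ⟨0, le_rfl, mul_zero r, by simpa using hr0⟩
    ⟨N * r, fun y ⟨hy, hry, hgy⟩ => by
      calc y = r * y := hry.symm
        _ ≤ N * (r * g) * y := mul_le_mul_of_nonneg_right hlow hy
        _ = N * (r * (g * y)) := by simp only [mul_assoc]
        _ ≤ N * (r * r) := by gcongr
        _ = N * r := by rw [hrr]⟩
  have hx0 : 0 ≤ x := hx.1 ⟨le_rfl, mul_zero r, by simpa using hr0⟩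
  have hrx : r * x = x := by
    refine le_antisymm ?_ (hx.2 fun y ⟨_, hry, hgy⟩ => ?_)
    · have := mul_nonneg hr1 hx0
      rwa [sub_mul, one_mul, sub_nonneg] at this
    · rw [← hry]
      exact mul_le_mul_of_nonneg_left (hx.1 ⟨‹_›, hry, hgy⟩) hr0
  have hgx : g * x ≤ r := by
    -- As g ≤ 1 on r, g * x - r ≤ g * (x - y) ≤ x - y, which replaces order continuity of
    -- multiplication.
    have h1 : x ≤ x - (g * x - r) := hx.2 fun y hy => by
      have h2 := hbd (x - y) (sub_nonneg.2 (hx.1 hy)) (by rw [mul_sub, hrx, hy.2.1])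
      rw [mul_sub] at h2
      have h3 : g * x - r ≤ x - y := (sub_le_sub_left hy.2.2 _).trans h2
      exact le_sub_comm.1 h3
    simpa using h1
  refine ⟨x, hx0, hrx, le_antisymm hgx ?_⟩
  have hd0 : 0 ≤ r - g * x := sub_nonneg.2 hgx
  have hrd : r * (r - g * x) = r - g * x := by
    rw [mul_sub, hrr, mul_comm_of_component hr (g * x), mul_assoc,
      ← mul_comm_of_component hr x, hrx]
  -- Adding the defect to x gives another subsolution, so the defect vanishes.
  have h1 : x + (r - g * x) ≤ x := hx.1 ⟨add_nonneg hx0 hd0, by rw [mul_add, hrx, hrd], by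
    rw [mul_add]
    calc g * x + g * (r - g * x) ≤ g * x + (r - g * x) := by gcongr; exact hbd _ hd0 hrd
      _ = r := by abel⟩
  simpa using h1

variable [Algebra ℝ F] [PosSMulMono ℝ F]

/-- Below a component `r` of the unit on which `g` is bounded and bounded away from `0`, the element
`g` has a right inverse. -/
theorem exists_inverse_of_bounded (hF : IsDedekindComplete F) {g r : F} {n m : ℕ}
    (hr : r ⊓ (1 - r) = 0) (hlow : r ≤ n * (r * g)) (hup : r * g ≤ m * r) :
    ∃ x, 0 ≤ x ∧ r * x = x ∧ g * x = r := by
  have hr0 : 0 ≤ r := hr ▸ inf_le_left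
  have hcast : ∀ k : ℕ, (k : F) = algebraMap ℝ F k := fun k => by simp
  have hM : (0 : ℝ) < m + 1 := by positivity
  -- Rescaling gives t • g ≤ 1 on r; m + 1 covers m = 0.
  set t : ℝ := (m + 1 : ℝ)⁻¹
  have ht : 0 ≤ t := by positivity
  have hmt : (((m + 1 : ℕ) : ℝ)) * t = 1 := by push_cast; exact mul_inv_cancel₀ hM.ne'
  obtain ⟨x, hx0, hrx, hgx⟩ := exists_inverse_of_le_component hF (g := t • g) (r := r)
    (N := (n : F) * ((m + 1 : ℕ) : F)) (by positivity) hr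
    (by
      rw [mul_smul_comm, mul_assoc, mul_smul_comm, hcast (m + 1), ← Algebra.smul_def, smul_smul,
        mul_comm t, hmt, one_smul]
      exact hlow)
    (by
      rw [mul_smul_comm]
      have h1 : r * g ≤ ((m + 1 : ℕ) : F) * r := by
        push_cast
        rw [add_mul, one_mul]
        exact hup.trans (le_add_of_nonneg_right hr0)
      have h2 := smul_le_smul_of_nonneg_left h1 ht
      rwa [hcast, ← Algebra.smul_def, smul_smul, mul_comm t, hmt, one_smul] at h2)
  exact ⟨t • x, smul_nonneg ht hx0, by rw [mul_smul_comm, hrx],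
    by rw [mul_smul_comm, ← smul_mul_assoc, hgx]⟩

/-- `x` is a positive right inverse of `g` relative to the component `g * x` of the unit. -/
def IsLocalInverse (g x : F) : Prop :=
  0 ≤ x ∧ g * x * x = x ∧ g * x ⊓ (1 - g * x) = 0

theorem exists_inverse_of_nonneg (hF : IsUniversallyComplete F) {g : F} (hg : 0 ≤ g) :
    ∃ h, g * h = supp g ∧ h * g = supp g := by
  have hD := hF.1
  have hu := supp_inf_one_sub hD g
  have hug := supp_mul_self hD g
  have huu := mul_self_of_component hu
  obtain ⟨M, hM⟩ := zorn_subset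
    {M : Set F | (∀ x ∈ M, IsLocalInverse g x) ∧ M.Pairwise fun x y => x ⊓ y = 0} (by
      intro c hc hchain
      refine ⟨⋃₀ c, ⟨?_, ?_⟩, fun s hs => Set.subset_sUnion_of_mem hs⟩
      · rintro x ⟨s, hs, hxs⟩
        exact (hc hs).1 x hxs
      · exact (Set.pairwise_sUnion hchain.directedOn).2 fun s hs => (hc hs).2)
  obtain ⟨⟨hML, hMd⟩, hmax⟩ := hM
  have hloc0 : IsLocalInverse g 0 := by simp [IsLocalInverse]
  have hMne : M.Nonempty := by
    by_contra hne
    rw [Set.not_nonempty_iff_eq_empty] at hne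
    have : ({0} : Set F) ⊆ M := hmax ⟨by simpa using hloc0, by simp⟩ (by simp [hne])
    simp [hne] at this
  obtain ⟨s, hs⟩ := hF.2 M hMne (fun x hx => (hML x hx).1) hMd
  have hproj : ∀ x ∈ M, g * x * s = x := by
    intro x hx
    obtain ⟨hx0, hpx, hp⟩ := hML x hx
    have hp0 : 0 ≤ g * x := mul_nonneg hg hx0
    have hp1 : 0 ≤ 1 - g * x := hp ▸ inf_le_right
    have hs0 : 0 ≤ s := hx0.trans (hs.1 hx)
    apply le_antisymm
    -- The factor 1 - g * x fixes every other member of M, so the right side is an upper bound.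
    · have h1 : s ≤ (1 - g * x) * s + x := hs.2 fun y hy => by
        rcases eq_or_ne x y with rfl | hxy
        · exact le_add_of_nonneg_left (mul_nonneg hp1 hs0)
        · have h2 : x * y = 0 := mul_eq_zero_of_inf_eq_zero (hMd hx hy hxy)
          have h3 : (1 - g * x) * y = y := by
            rw [sub_mul, one_mul, mul_assoc, h2, mul_zero, sub_zero]
          calc y = (1 - g * x) * y := h3.symm
            _ ≤ (1 - g * x) * s := mul_le_mul_of_nonneg_left (hs.1 hy) hp1
            _ ≤ _ := le_add_of_nonneg_right hx0
      rw [sub_mul, one_mul, sub_add_eq_add_sub, le_sub_iff_add_le] at h1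
      exact le_of_add_le_add_left h1
    · calc x = g * x * x := hpx.symm
        _ ≤ g * x * s := mul_le_mul_of_nonneg_left (hs.1 hx) hp0
  have hd : supp g - g * s = 0 := by
    by_contra hne
    obtain ⟨r, n, m, hrne, hr, hlow, hup, hrd⟩ := exists_component_bounded hD hg hne (by
      rw [mul_sub, huu, ← mul_assoc, hug])
    obtain ⟨x, hx0, hrx, hgx⟩ := exists_inverse_of_bounded hD hr hlow hup
    -- Each g * y kills the defect, hence also r, which a multiple of r * |defect| dominates.
    have hrp : ∀ y ∈ M, g * y * r = 0 := by
      intro y hy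
      obtain ⟨hy0, hpy, hp⟩ := hML y hy
      have hp0 : 0 ≤ g * y := mul_nonneg hg hy0
      have h1 : g * y * (supp g - g * s) = 0 := by
        rw [mul_sub, ← mul_assoc (g * y), mul_comm_of_component hp g, mul_assoc g _ s,
          hproj y hy, ← mul_comm_of_component hu, ← mul_assoc, hug, sub_self]
      have h2 := mul_abs_eq_zero hp0 h1
      refine le_antisymm ?_ (mul_nonneg hp0 (hr ▸ inf_le_left))
      refine (mul_le_mul_of_nonneg_left hrd hp0).trans_eq ?_
      rw [← mul_assoc, ← (Nat.cast_commute n (g * y)).eq, mul_assoc,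
        mul_comm_of_component hr, ← mul_assoc (g * y), h2, zero_mul, mul_zero]
    have hxM : x ∈ M := by
      refine hmax (y := insert x M) ⟨?_, ?_⟩ (Set.subset_insert x M) (Set.mem_insert x M)
      · rintro y (rfl | hy)
        · exact ⟨hx0, by rw [hgx, hrx], by rw [hgx, hr]⟩
        · exact hML y hy
      · suffices hdisj : ∀ y ∈ M, y ⊓ x = 0 from
          Set.pairwise_insert.2 ⟨hMd, fun y hy _ => ⟨inf_comm x y ▸ hdisj y hy, hdisj y hy⟩⟩
        intro y hy
        obtain ⟨hy0, hpy, hp⟩ := hML y hy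
        refine inf_eq_zero_of_mul_eq_zero hD hy0 hx0 ?_
        rw [← hpy, ← hrx, mul_comm_of_component hp y, mul_assoc, ← mul_assoc (g * y),
          hrp y hy, zero_mul, mul_zero]
    have h1 := hrp x hxM
    rw [hgx, mul_self_of_component hr] at h1
    exact hrne h1
  have hgs : g * s = supp g := (sub_eq_zero.1 hd).symm
  have hgus : g * (supp g * s) = supp g := by
    rw [← mul_assoc, ← mul_comm_of_component hu, hug, hgs]
  refine ⟨supp g * s, hgus, left_inverse_of_right_inverse hu hug (by rw [← mul_assoc, huu]) hgus
    fun k hk hgk => supp_mul_eq_zero hD hk (mul_eq_zero_symm hD hg hk hgk)⟩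

theorem exists_inverse (hF : IsUniversallyComplete F) (g : F) :
    ∃ h, g * h = supp g ∧ h * g = supp g := by
  obtain ⟨i, hi, hi'⟩ := exists_inverse_of_nonneg hF (mul_self_nonneg' g)
  rw [supp_mul_self_eq hF.1] at hi hi'
  have hu := supp_inf_one_sub hF.1 g
  have hug := supp_mul_self hF.1 g
  have hgu : g * supp g = g := by rw [← mul_comm_of_component hu, hug]
  refine ⟨g * i, by rw [← mul_assoc, hi], ?_⟩
  -- Both sides equal i * g * g * g * i.
  have : g * i = i * g :=
    calc g * i = supp g * g * i := by rw [hug]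
      _ = i * (g * g) * g * i := by rw [hi']
      _ = i * g * (g * g * i) := by simp only [mul_assoc]
      _ = i * g := by rw [hi, mul_assoc, hgu]
  rw [this, mul_assoc, hi']

end Inverse

end RieszSpace

/-! ### The four assertions -/

theorem theorem5p2 {F : Type*} [Ring F] [Lattice F] [IsOrderedAddMonoid F]
    [Algebra ℝ F] [PosSMulMono ℝ F] [RieszSpace.IsFAlgebra F]
    (hF : RieszSpace.IsUniversallyComplete F)
    (e : F) (he : RieszSpace.IsWeakOrderUnit e) (he1 : e = 1) :
    (∀ g : F, ∃ h : F, RieszSpace.IsPartialInverse e g h) ∧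
    (∀ g : F, ∃! h : F, RieszSpace.IsCanonicalPartialInverse e g h) ∧
    (∀ g h : F, RieszSpace.IsCanonicalPartialInverse e g h →
      RieszSpace.IsCanonicalPartialInverse e h g) ∧
    (∀ g h : F, 0 ≤ g → RieszSpace.IsCanonicalPartialInverse e g h → 0 ≤ h) := by
  subst he1
  have hD := hF.1
  have hcomp := RieszSpace.supp_inf_one_sub hD
  have hex : ∀ g : F, ∃ h : F, RieszSpace.IsCanonicalPartialInverse 1 g h := by
    intro g
    obtain ⟨h, hgh, hhg⟩ := RieszSpace.exists_inverse hF g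
    have hu := hcomp g
    have huu := RieszSpace.mul_self_of_component hu
    refine ⟨RieszSpace.supp g * h, ⟨?_, ?_⟩, (RieszSpace.mem_bandGen_iff hD).2 ?_⟩
    · change g * (RieszSpace.supp g * h) = RieszSpace.supp g
      rw [← mul_assoc, ← RieszSpace.mul_comm_of_component hu, mul_assoc, hgh, huu]
    · change RieszSpace.supp g * h * g = RieszSpace.supp g
      rw [mul_assoc, hhg, huu]
    · rw [← mul_assoc, huu]
  refine ⟨fun g => (hex g).imp fun h hh => hh.1, fun g => ?_, ?_, ?_⟩
  · obtain ⟨h, hh⟩ := hex g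
    refine ⟨h, hh, fun k hk => ?_⟩
    have hgh : g * h = RieszSpace.supp g := hh.1.1
    have hkg : k * g = RieszSpace.supp g := hk.1.2
    calc k = RieszSpace.supp g * k := ((RieszSpace.mem_bandGen_iff hD).1 hk.2).symm
      _ = k * (g * h) := by rw [RieszSpace.mul_comm_of_component (hcomp g), hgh]
      _ = RieszSpace.supp g * h := by rw [← mul_assoc, hkg]
      _ = h := (RieszSpace.mem_bandGen_iff hD).1 hh.2
  · rintro g h ⟨⟨hgh, hhg⟩, hmem⟩
    change g * h = RieszSpace.supp g at hgh
    change h * g = RieszSpace.supp g at hhg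
    -- Write g = g * h * g and move the central `supp h` next to h.
    have h1 : RieszSpace.supp h * g = g :=
      calc RieszSpace.supp h * g = RieszSpace.supp h * (g * h * g) := by
            rw [hgh, RieszSpace.supp_mul_self hD]
        _ = g * (RieszSpace.supp h * h) * g := by
            rw [← mul_assoc, ← mul_assoc, RieszSpace.mul_comm_of_component (hcomp h) g,
              mul_assoc g]
        _ = g := by rw [RieszSpace.supp_mul_self hD, hgh, RieszSpace.supp_mul_self hD]
    have h2 : RieszSpace.supp g = RieszSpace.supp h :=
      RieszSpace.supp_eq_supp hD ((RieszSpace.mem_bandGen_iff hD).1 hmem) h1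
    exact ⟨⟨hhg.trans h2, hgh.trans h2⟩, (RieszSpace.mem_bandGen_iff hD).2 h1⟩
  · rintro g h hg ⟨⟨hgh, hhg⟩, hmem⟩
    -- This writes h as a square times g, a product of positive elements.
    have h1 : h * h * g = h := by
      have h2 := (RieszSpace.mem_bandGen_iff hD).1 hmem
      rw [mul_assoc, hhg]
      exact (RieszSpace.mul_comm_of_component (hcomp g) h).symm.trans h2
    rw [← h1]
    exact mul_nonneg (RieszSpace.mul_self_nonneg' h) hg
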